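/- For integers $m\ge 2$ and $0\le r\le m$, the binary Reed–Muller code $\mathcal R(r,m)\subseteq\mathbb F_2^{2^m}$ is the linear code of length $2^m$ consisting of the vectors $(f(x))_{x\in\mathbb F_2^m}$, where $f$ runs over the polynomials in $m$ variables over $\mathbb F_2$ of total degree at most $r$. For a linear code $\mathcal C$ of length $n$ let $A_i$ be the number of codewords of Hamming weight $i$, for $0\le i\le n$; the nonzero weight distribution of $\mathcal C$ is the subsequence of $A_0,A_1,\dots,A_n$ consisting of its nonzero terms, in the same order. The code $\mathcal C$ is called log-concave if its nonzero weight distribution $a_0,\dots,a_s$ satisfies $a_i^2\ge a_{i-1}a_{i+1}$ for all $1\le i\le s-1$. Theorem. For every integer $m\ge 2$, the second order Reed–Muller code $\mathcal R(2,m)$ is log-concave. Moreover, its nonzero weight distribution $a_0,\dots,a_s$ is unimodal with peak at weight $2^{m-1}$: the number $A_{2^{m-1}}$ is nonzero, and if $a_j$ is the term $A_{2^{m-1}}$ of this sequence, then $a_0\le a_1\le\cdots\le a_j\ge a_{j+1}\ge\cdots\ge a_s$. -/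

import Mathlib

namespace CodeLogConcave

/-- A finite sequence `a₀, …, aₙ` is log-concave if `aᵢ₋₁ * aᵢ₊₁ ≤ aᵢ ^ 2` for `1 ≤ i ≤ n - 1`. -/
def IsLogConcave {R : Type*} [Semiring R] [LE R] (a : List R) : Prop :=
  ∀ (i : ℕ) (h : i + 2 < a.length), a[i] * a[i + 2] ≤ a[i + 1] ^ 2

/-- The finite sequence `a₀, …, aₙ` is unimodal with peak index `j`:
`a₀ ≤ ⋯ ≤ aⱼ ≥ ⋯ ≥ aₙ` and `0 ≤ j ≤ n`. -/
def IsUnimodalAt {R : Type*} [LE R] (a : List R) (j : ℕ) : Prop :=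
  j < a.length ∧
    (∀ (i : ℕ) (h : i + 1 < a.length), i + 1 ≤ j → a[i] ≤ a[i + 1]) ∧
    (∀ (i : ℕ) (h : i + 1 < a.length), j ≤ i → a[i + 1] ≤ a[i])

section Codes

variable {ι F : Type*} [Fintype ι] [Field F] [DecidableEq F]

/-- `A_i`: the number of codewords of Hamming weight `i`. -/
noncomputable def weightDist (C : Submodule F (ι → F)) (i : ℕ) : ℕ :=
  {c : ι → F | c ∈ C ∧ hammingNorm c = i}.ncard

/-- The weights `i ∈ {0, …, n}` with `A_i ≠ 0`, in increasing order, `n` being the length. -/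
noncomputable def weights (C : Submodule F (ι → F)) : List ℕ :=
  (List.range (Fintype.card ι + 1)).filter fun i => weightDist C i ≠ 0

/-- The nonzero weight distribution: the subsequence of `A_0, …, A_n` of its nonzero values. -/
noncomputable def nonzeroWeightDist (C : Submodule F (ι → F)) : List ℕ :=
  (weights C).map (weightDist C)

end Codes

/-- The binary Reed–Muller code `R(r, m)`, of length `2 ^ m`: the evaluation vectors, at all the
points of `𝔽₂ᵐ`, of the polynomials over `𝔽₂` in `m` variables of total degree at most `r`. -/
noncomputable def reedMuller (r m : ℕ) : Submodule (ZMod 2) ((Fin m → ZMod 2) → ZMod 2) :=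
  (MvPolynomial.restrictTotalDegree (Fin m) (ZMod 2) r).map
    (MvPolynomial.evalₗ (ZMod 2) (Fin m))

end CodeLogConcave

/-! Codewords of `reedMuller 2 m` are the functions `f` on `𝔽₂ᵐ` with biadditive second difference
(`mem_reedMuller_two_iff`), and the weight of `f` is read off from `charSum f`, which is `2 ^ m`
minus twice the weight. Squaring the sum shows that it is zero or that its square is `2 ^ m` times
the order of the radical (`charSum_sq`). The polar form has even rank `2 * h`, so the nonzero sums
are `± 2 ^ (m - h)`.

Averaging over translates by linear forms turns the weight enumeration into a rank enumeration. If
`M_h` is the number of quadratic functions of rank `2 * h`, then each sum `± 2 ^ (m - h)` occurs `4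
^ h * M_h / (2 * 2 ^ m)` times (`two_mul_card_mul_charSumCount`), and the sum `0` accounts for the
rest (`card_mul_charSumCount_zero`). Adding one variable gives a recurrence for `M_h`, whose
solution is the closed ratio `M_(h+1) / M_h` of `rankCount_ratio`.

The ratio decreases in `h`, which gives log-concavity below the middle (`rankCount_logConcave`). It
also makes `M_h` grow so fast, except perhaps at the last step, that the balanced count is
controlled by its last two terms (`balanced_bounds`). The distribution is symmetric under `f ↦ f +
1`, so it is the nondecreasing log-concave sequence `halfSeq` reflected at its last term, and both
claims follow (`isLogConcave_reflect`, `isUnimodalAt_reflect`). -/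

namespace CodeLogConcave

/-! ### Quadratic functions, polar forms and radicals. -/

section QuadraticFunctions

variable {V : Type*} [AddCommGroup V]

/-- The second difference of `f`, based at the origin. -/
def polarFun (f : V → ZMod 2) (x y : V) : ZMod 2 := f (x + y) + f x + f y + f 0

/-- Functions of degree at most two: those with a biadditive second difference. -/
def IsQuad (f : V → ZMod 2) : Prop :=
  ∀ x y z, polarFun f (x + y) z = polarFun f x z + polarFun f y z

/-- The radical of the polar form. -/
def radical (f : V → ZMod 2) : Set V := {x | ∀ y, polarFun f x y = 0}

/-- The order of the radical of the polar form. -/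
noncomputable def radCard (f : V → ZMod 2) : ℕ := Nat.card (radical f)

theorem polarFun_comm (f : V → ZMod 2) (x y : V) : polarFun f x y = polarFun f y x := by
  simp only [polarFun, add_comm x y]; ring

theorem zmod_two_add_self (a : ZMod 2) : a + a = 0 := CharTwo.add_self_eq_zero a

theorem polarFun_zero_left (f : V → ZMod 2) (y : V) : polarFun f 0 y = 0 := by
  simp only [polarFun, zero_add]
  linear_combination zmod_two_add_self (f y) + zmod_two_add_self (f 0)

theorem polarFun_add (f g : V → ZMod 2) (x y : V) :
    polarFun (f + g) x y = polarFun f x y + polarFun g x y := by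
  simp only [polarFun, Pi.add_apply]; ring

theorem polarFun_add_one (f : V → ZMod 2) : polarFun (f + 1) = polarFun f := by
  ext x y
  simp only [polarFun, Pi.add_apply, Pi.one_apply]
  linear_combination 2 * zmod_two_add_self 1

theorem isQuad_add_one {f : V → ZMod 2} : IsQuad (f + 1) ↔ IsQuad f := by
  simp only [IsQuad, polarFun_add_one]

variable [Module (ZMod 2) V]

theorem module_add_self (x : V) : x + x = 0 := by
  rw [← two_smul (ZMod 2) x, show (2 : ZMod 2) = 0 from rfl, zero_smul]

theorem polarFun_self (f : V → ZMod 2) (x : V) : polarFun f x x = 0 := by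
  simp only [polarFun, module_add_self]
  linear_combination zmod_two_add_self (f x) + zmod_two_add_self (f 0)

/-- The polar form of a quadratic function as a bilinear map. -/
def polarBilin {f : V → ZMod 2} (hf : IsQuad f) : V →ₗ[ZMod 2] Module.Dual (ZMod 2) V :=
  AddMonoidHom.toZModLinearMap 2
    { toFun := fun x => AddMonoidHom.toZModLinearMap 2
        { toFun := fun y => polarFun f x y
          map_zero' := by rw [polarFun_comm, polarFun_zero_left]
          map_add' := fun y z => by
            rw [polarFun_comm, hf, polarFun_comm f y, polarFun_comm f z] }
      map_zero' := by ext y; exact polarFun_zero_left f y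
      map_add' := fun x y => by ext z; exact hf x y z }

@[simp]
theorem polarBilin_apply {f : V → ZMod 2} (hf : IsQuad f) (x y : V) :
    polarBilin hf x y = polarFun f x y := rfl

theorem mem_ker_polarBilin {f : V → ZMod 2} (hf : IsQuad f) (x : V) :
    x ∈ LinearMap.ker (polarBilin hf) ↔ x ∈ radical f := by
  rw [LinearMap.mem_ker]
  exact ⟨fun h y => by rw [← polarBilin_apply hf, h]; rfl, fun h => LinearMap.ext h⟩

theorem card_ker_polarBilin {f : V → ZMod 2} (hf : IsQuad f) :
    Nat.card (LinearMap.ker (polarBilin hf)) = radCard f :=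
  Nat.card_congr (Equiv.subtypeEquivRight (mem_ker_polarBilin hf))

theorem polarFun_linear (l : Module.Dual (ZMod 2) V) (x y : V) : polarFun l x y = 0 := by
  simp only [polarFun, map_add, map_zero]
  linear_combination zmod_two_add_self (l x) + zmod_two_add_self (l y)

theorem polarFun_add_linear (f : V → ZMod 2) (l : Module.Dual (ZMod 2) V) :
    polarFun (f + ⇑l) = polarFun f := by
  ext x y; rw [polarFun_add, polarFun_linear, add_zero]

theorem isQuad_add_linear {f : V → ZMod 2} (l : Module.Dual (ZMod 2) V) :
    IsQuad (f + ⇑l) ↔ IsQuad f := by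
  simp only [IsQuad, polarFun_add_linear]

theorem radical_add_linear (f : V → ZMod 2) (l : Module.Dual (ZMod 2) V) :
    radical (f + ⇑l) = radical f := by
  simp only [radical, polarFun_add_linear]

theorem radCard_add_linear (f : V → ZMod 2) (l : Module.Dual (ZMod 2) V) :
    radCard (f + ⇑l) = radCard f := by
  simp only [radCard, radical_add_linear]

end QuadraticFunctions

/-! ### Linear forms on finite spaces over `𝔽₂`. -/

section LinearForms

variable {V : Type*} [AddCommGroup V] [Module (ZMod 2) V] [Finite V]

theorem card_zmod_two_module (W : Type*) [AddCommGroup W] [Module (ZMod 2) W] [Finite W] :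
    Nat.card W = 2 ^ Module.finrank (ZMod 2) W := by
  rw [Module.natCard_eq_pow_finrank (K := ZMod 2), Nat.card_zmod]

/-- The number of extensions of a linear form on a subspace. -/
theorem card_extensions (W : Submodule (ZMod 2) V) (φ : W →ₗ[ZMod 2] ZMod 2) :
    Nat.card {l : Module.Dual (ZMod 2) V // ∀ x : W, l x = φ x} * Nat.card W = Nat.card V := by
  obtain ⟨l₀, hl₀⟩ := LinearMap.exists_extend φ
  have e : {l : Module.Dual (ZMod 2) V // ∀ x : W, l x = φ x} ≃ W.dualAnnihilator :=
    { toFun := fun l => ⟨l.1 - l₀, by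
        rw [Submodule.mem_dualAnnihilator]
        intro w hw
        rw [LinearMap.sub_apply, l.2 ⟨w, hw⟩, ← hl₀]
        simp⟩
      invFun := fun l => ⟨l.1 + l₀, fun x => by
        have := (Submodule.mem_dualAnnihilator _).1 l.2 x x.2
        rw [LinearMap.add_apply, this, ← hl₀]
        simp⟩
      left_inv := fun l => by ext; simp
      right_inv := fun l => by ext; simp }
  have : Finite (Module.Dual (ZMod 2) V) := DFunLike.finite _
  rw [Nat.card_congr e, card_zmod_two_module, card_zmod_two_module, card_zmod_two_module,
    ← pow_add, add_comm, Subspace.finrank_add_finrank_dualAnnihilator_eq]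

theorem card_dual : Nat.card (Module.Dual (ZMod 2) V) = Nat.card V := by
  have : Finite (Module.Dual (ZMod 2) V) := DFunLike.finite _
  rw [card_zmod_two_module, card_zmod_two_module, Subspace.dual_finrank_eq]

/-- A linear form vanishing on the radical is represented by the polar form. -/
theorem exists_polarBilin_eq {f : V → ZMod 2} (hf : IsQuad f) (l : Module.Dual (ZMod 2) V)
    (hl : ∀ x ∈ radical f, l x = 0) : ∃ z, polarBilin hf z = l := by
  have hmem : l ∈ (LinearMap.ker (polarBilin hf)).dualAnnihilator :=
    (Submodule.mem_dualAnnihilator _).2 fun w hw => hl w ((mem_ker_polarBilin hf w).1 hw)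
  rw [← LinearMap.range_dualMap_eq_dualAnnihilator_ker] at hmem
  obtain ⟨ψ, hψ⟩ := hmem
  obtain ⟨z, rfl⟩ := (Module.evalEquiv (ZMod 2) V).surjective ψ
  refine ⟨z, ?_⟩
  rw [← hψ]
  ext y
  exact polarFun_comm f z y

end LinearForms

/-! ### Character sums of quadratic functions. -/

section CharacterSums

/-- The nontrivial character of `𝔽₂`. -/
def sgn (a : ZMod 2) : ℤ := if a = 0 then 1 else -1

theorem sgn_add : ∀ a b : ZMod 2, sgn (a + b) = sgn a * sgn b := by decide

theorem sgn_eq_one_sub : ∀ a : ZMod 2, sgn a = 1 - 2 * (if a ≠ 0 then 1 else 0) := by decide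

/-- The character sum `∑ (-1) ^ f x`. -/
def charSum {V : Type*} [Fintype V] (f : V → ZMod 2) : ℤ := ∑ x, sgn (f x)

open Classical in
theorem sum_sgn_of_additive {G : Type*} [AddCommGroup G] [Fintype G] (g : G → ZMod 2)
    (hg : ∀ x y, g (x + y) = g x + g y) :
    ∑ x, sgn (g x) = if ∀ x, g x = 0 then (Fintype.card G : ℤ) else 0 := by
  split_ifs with h
  · simp [h, sgn]
  · push Not at h
    obtain ⟨a, ha⟩ := h
    have h1 : ∑ x, sgn (g x) = ∑ x, sgn (g (a + x)) :=
      (Equiv.sum_comp (Equiv.addLeft a) fun x => sgn (g x)).symm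
    have h2 : ∀ x, sgn (g (a + x)) = - sgn (g x) := fun x => by
      rw [hg, sgn_add, show sgn (g a) = -1 from if_neg ha, neg_one_mul]
    simp only [h2, Finset.sum_neg_distrib] at h1
    linarith

theorem charSum_add_one {V : Type*} [Fintype V] (f : V → ZMod 2) :
    charSum (f + 1) = - charSum f := by
  simp only [charSum, Pi.add_apply, Pi.one_apply, sgn_add, show sgn 1 = -1 from rfl, mul_neg_one,
    Finset.sum_neg_distrib]

theorem charSum_eq_card_sub {V : Type*} [Fintype V] (f : V → ZMod 2) :
    charSum f = Fintype.card V - 2 * hammingNorm f := by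
  simp only [charSum, sgn_eq_one_sub, Finset.sum_sub_distrib, ← Finset.mul_sum, hammingNorm,
    Finset.card_filter]
  simp

variable {V : Type*} [AddCommGroup V]

theorem zero_mem_radical (f : V → ZMod 2) : (0 : V) ∈ radical f := polarFun_zero_left f

theorem sgn_mul_sgn_translate (f : V → ZMod 2) (x y : V) :
    sgn (f x) * sgn (f (x + y)) = sgn (polarFun f x y) * sgn (f y + f 0) := by
  rw [← sgn_add, ← sgn_add]
  congr 1
  simp only [polarFun]
  linear_combination -zmod_two_add_self (f y) - zmod_two_add_self (f 0)

theorem add_eq_of_mem_radical {f : V → ZMod 2} {x : V} (hx : x ∈ radical f) (y : V) :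
    f (x + y) + f 0 = (f x + f 0) + (f y + f 0) := by
  have := hx y
  simp only [polarFun] at this
  linear_combination this - zmod_two_add_self (f x) - zmod_two_add_self (f y)
    - zmod_two_add_self (f 0)

theorem radCard_pos [Finite V] (f : V → ZMod 2) : 0 < radCard f := by
  have : Nonempty (radical f) := ⟨⟨0, zero_mem_radical f⟩⟩
  exact Nat.card_pos

variable [Module (ZMod 2) V]

/-- The linear form induced by a quadratic function on its radical. -/
def radicalForm {f : V → ZMod 2} (hf : IsQuad f) :
    LinearMap.ker (polarBilin hf) →ₗ[ZMod 2] ZMod 2 :=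
  AddMonoidHom.toZModLinearMap 2
    { toFun := fun x => f x + f 0
      map_zero' := zmod_two_add_self (f 0)
      map_add' := fun x y => add_eq_of_mem_radical ((mem_ker_polarBilin hf _).1 x.2) y }

theorem radicalForm_apply {f : V → ZMod 2} (hf : IsQuad f)
    (x : LinearMap.ker (polarBilin hf)) : radicalForm hf x = f x + f 0 := rfl

variable [Fintype V]

open Classical in
/-- The square of the character sum of a quadratic function. -/
theorem charSum_sq {f : V → ZMod 2} (hf : IsQuad f) :
    charSum f ^ 2 =
      if ∀ x ∈ radical f, f x + f 0 = 0 then (Nat.card V : ℤ) * radCard f else 0 := by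
  have h1 : charSum f ^ 2 = ∑ y, ∑ x, sgn (polarFun f x y) * sgn (f y + f 0) := by
    rw [sq, charSum, Finset.sum_mul_sum, Finset.sum_comm (s := Finset.univ) (t := Finset.univ)
      (f := fun y x => sgn (polarFun f x y) * sgn (f y + f 0))]
    refine Finset.sum_congr rfl fun x _ => ?_
    -- Replacing the second variable by `x + y` makes the summand a character in `x` for each fixed
    -- `y`, so that only `y` in the radical contribute.
    rw [← Equiv.sum_comp (Equiv.addLeft x)]
    exact Finset.sum_congr rfl fun y _ => sgn_mul_sgn_translate f x y
  have h2 : ∀ y, ∑ x, sgn (polarFun f x y) * sgn (f y + f 0) =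
      if y ∈ LinearMap.ker (polarBilin hf) then (Nat.card V : ℤ) * sgn (f y + f 0) else 0 := by
    intro y
    rw [← Finset.sum_mul, sum_sgn_of_additive _ fun x x' => hf x x' y, ite_mul, zero_mul,
      Nat.card_eq_fintype_card]
    refine if_congr ?_ rfl rfl
    rw [mem_ker_polarBilin]
    exact forall_congr' fun x => by rw [polarFun_comm]
  rw [h1, Finset.sum_congr rfl fun y _ => h2 y, ← Finset.sum_filter, ← Finset.mul_sum,
    Finset.sum_subtype (p := fun y => y ∈ LinearMap.ker (polarBilin hf)) _ (by simp)
      fun y => sgn (f y + f 0)]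
  have h3 : ∑ x : LinearMap.ker (polarBilin hf), sgn (f x + f 0) = _ :=
    sum_sgn_of_additive (radicalForm hf) (map_add _)
  have h4 : (∀ x, radicalForm hf x = 0) ↔ ∀ x ∈ radical f, f x + f 0 = 0 :=
    ⟨fun h x hx => h ⟨x, (mem_ker_polarBilin hf x).2 hx⟩,
      fun h x => h x ((mem_ker_polarBilin hf x).1 x.2)⟩
  rw [h3, ← card_ker_polarBilin hf, Nat.card_eq_fintype_card, Nat.card_eq_fintype_card]
  by_cases h : ∀ x ∈ radical f, f x + f 0 = 0
  · rw [if_pos h, if_pos (h4.2 h)]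
  · rw [if_neg h, if_neg (mt h4.1 h), mul_zero]

theorem charSum_ne_zero_iff {f : V → ZMod 2} (hf : IsQuad f) :
    charSum f ≠ 0 ↔ ∀ x ∈ radical f, f x + f 0 = 0 := by
  classical
  rw [← pow_ne_zero_iff two_ne_zero, charSum_sq hf]
  have h1 := radCard_pos f
  have h2 : 0 < Nat.card V := Nat.card_pos
  have h3 : (Nat.card V : ℤ) * radCard f ≠ 0 := by positivity
  by_cases h : ∀ x ∈ radical f, f x + f 0 = 0
  · rw [if_pos h]
    exact iff_of_true h3 h
  · rw [if_neg h]
    exact iff_of_false (fun h0 => h0 rfl) h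

theorem charSum_sq_of_ne_zero {f : V → ZMod 2} (hf : IsQuad f) (h : charSum f ≠ 0) :
    charSum f ^ 2 = (Nat.card V : ℤ) * radCard f := by
  classical
  rw [charSum_sq hf, if_pos ((charSum_ne_zero_iff hf).1 h)]

/-- The number of nonzero Walsh coefficients of a quadratic function. -/
theorem card_charSum_ne_zero {f : V → ZMod 2} (hf : IsQuad f) :
    Nat.card {l : Module.Dual (ZMod 2) V // charSum (f + ⇑l) ≠ 0} * radCard f = Nat.card V := by
  rw [← card_ker_polarBilin hf, ← card_extensions (LinearMap.ker (polarBilin hf)) (radicalForm hf)]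
  congr 1
  -- The sum of `f + l` is nonzero exactly when `l` extends the linear form that `f` induces on its
  -- radical.
  refine Nat.card_congr (Equiv.subtypeEquivRight fun l => ?_)
  rw [charSum_ne_zero_iff ((isQuad_add_linear l).2 hf), radical_add_linear]
  simp only [Pi.add_apply, map_zero, add_zero, radicalForm_apply]
  constructor
  · intro h x
    have := h x ((mem_ker_polarBilin hf x).1 x.2)
    linear_combination this - zmod_two_add_self (f x) - zmod_two_add_self (f 0)
  · intro h x hx
    have := h ⟨x, (mem_ker_polarBilin hf x).2 hx⟩
    linear_combination this + zmod_two_add_self (f x) + zmod_two_add_self (f 0)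

/-- The polar form has even rank. -/
theorem exists_radCard_mul_four_pow {f : V → ZMod 2} (hf : IsQuad f) :
    ∃ h, radCard f * 4 ^ h = Nat.card V := by
  have hpos : 0 < Nat.card V := Nat.card_pos
  have hc := card_charSum_ne_zero hf
  have : Nonempty {l : Module.Dual (ZMod 2) V // charSum (f + ⇑l) ≠ 0} := by
    by_contra hne
    rw [not_nonempty_iff] at hne
    rw [Nat.card_of_isEmpty, zero_mul] at hc
    omega
  obtain ⟨l, hl⟩ := this
  have hsq := charSum_sq_of_ne_zero ((isQuad_add_linear l).2 hf) hl
  rw [radCard_add_linear, ← card_ker_polarBilin hf, card_zmod_two_module, card_zmod_two_module,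
    ← Int.natAbs_sq] at hsq
  have hle := Submodule.finrank_le (LinearMap.ker (polarBilin hf))
  have hcard : radCard f = 2 ^ Module.finrank (ZMod 2) (LinearMap.ker (polarBilin hf)) := by
    rw [← card_ker_polarBilin hf, card_zmod_two_module]
  rw [hcard, card_zmod_two_module V]
  generalize Module.finrank (ZMod 2) (LinearMap.ker (polarBilin hf)) = r at *
  generalize Module.finrank (ZMod 2) V = m at *
  norm_cast at hsq
  rw [← pow_add] at hsq
  -- A nonzero sum has square `2 ^ (m + r)`, where `r` is the dimension of the radical; hence `m + r
  -- = 2 * k`, and the rank `m - r` equals `2 * (k - r)`.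
  obtain ⟨k, -, hk⟩ := (Nat.dvd_prime_pow Nat.prime_two).1
    (Dvd.intro_left _ (by rw [← hsq, sq]) : (charSum (f + ⇑l)).natAbs ∣ 2 ^ (m + r))
  rw [hk, ← pow_mul] at hsq
  have hkr := Nat.pow_right_injective le_rfl hsq
  refine ⟨k - r, ?_⟩
  rw [show 4 = 2 ^ 2 from rfl, ← pow_mul, ← pow_add]
  congr 1
  omega

end CharacterSums

/-! ### Elementary counting lemmas. -/

section Counting

theorem card_subtype_eq_sum {α : Type*} [Fintype α] (P : α → Prop) [DecidablePred P] :
    Nat.card {a // P a} = ∑ a, if P a then 1 else 0 := by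
  rw [Nat.card_eq_fintype_card, Fintype.card_subtype, Finset.card_filter]

theorem card_subtype_prod {α β : Type*} [Fintype α] [Finite β] (P : α → β → Prop) :
    Nat.card {p : α × β // P p.1 p.2} = ∑ a, Nat.card {b // P a b} := by
  rw [← Nat.card_sigma]
  exact Nat.card_congr
    { toFun := fun p => ⟨p.1.1, p.1.2, p.2⟩
      invFun := fun p => ⟨(p.1, p.2.1), p.2.2⟩
      left_inv := fun _ => rfl
      right_inv := fun _ => rfl }

theorem card_subtype_eq_sum_range {α : Type*} [Finite α] (P : α → Prop) (R : α → ℕ → Prop) (K : ℕ)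
    (hR : ∀ a, P a → ∃! k, k < K ∧ R a k) :
    Nat.card {a // P a} = ∑ k ∈ Finset.range K, Nat.card {a // P a ∧ R a k} := by
  classical
  have := Fintype.ofFinite α
  simp only [card_subtype_eq_sum]
  rw [Finset.sum_comm]
  refine Finset.sum_congr rfl fun a _ => ?_
  by_cases hP : P a
  · obtain ⟨k, ⟨hk, hRk⟩, huniq⟩ := hR a hP
    rw [Finset.sum_eq_single k, if_pos hP, if_pos ⟨hP, hRk⟩]
    · intro j hj hjk
      exact if_neg fun h => hjk (huniq j ⟨Finset.mem_range.1 hj, h.2⟩)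
    · intro h
      exact absurd (Finset.mem_range.2 hk) h
  · simp [hP]

theorem card_subtype_add_not {α : Type*} [Finite α] (P R : α → Prop) :
    Nat.card {a // P a ∧ R a} + Nat.card {a // P a ∧ ¬ R a} = Nat.card {a // P a} := by
  classical
  have := Fintype.ofFinite α
  simp only [card_subtype_eq_sum, ← Finset.sum_add_distrib]
  refine Finset.sum_congr rfl fun a _ => ?_
  by_cases P a <;> by_cases R a <;> simp [*]

end Counting

/-! ### From rank counts to the distribution of character sums. -/

section CharacterSumDistribution

variable (V : Type*) [AddCommGroup V]

/-- The number of quadratic functions whose polar form has rank `2 * h`. -/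
noncomputable def quadCount (h : ℕ) : ℕ :=
  Nat.card {f : V → ZMod 2 // IsQuad f ∧ radCard f * 4 ^ h = Nat.card V}

/-- The number of quadratic functions with character sum `s`. -/
noncomputable def charSumCount [Fintype V] (s : ℤ) : ℕ :=
  Nat.card {f : V → ZMod 2 // IsQuad f ∧ charSum f = s}

variable [Fintype V]

theorem charSumCount_neg (s : ℤ) : charSumCount V (-s) = charSumCount V s :=
  Nat.card_congr
    { toFun := fun f => ⟨f.1 + 1, isQuad_add_one.2 f.2.1, by rw [charSum_add_one, f.2.2, neg_neg]⟩
      invFun := fun f => ⟨f.1 + 1, isQuad_add_one.2 f.2.1, by rw [charSum_add_one, f.2.2]⟩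
      left_inv := fun f => by
        ext x; simp only [Pi.add_apply, Pi.one_apply, add_assoc, zmod_two_add_self, add_zero]
      right_inv := fun f => by
        ext x; simp only [Pi.add_apply, Pi.one_apply, add_assoc, zmod_two_add_self, add_zero] }

variable [Module (ZMod 2) V]

/-- Averaging over the translates by linear forms. -/
theorem card_mul_card_charSum_ne_zero (h : ℕ) :
    Nat.card V * Nat.card {f : V → ZMod 2 //
      (IsQuad f ∧ radCard f * 4 ^ h = Nat.card V) ∧ charSum f ≠ 0} = 4 ^ h * quadCount V h := by
  classical
  have : Finite (Module.Dual (ZMod 2) V) := DFunLike.finite _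
  have := Fintype.ofFinite (Module.Dual (ZMod 2) V)
  -- Pairs `(f, l)` with nonzero sum of `f + l` are counted twice: the bijection `(f, l) ↦ (f + l,
  -- l)` gives one side, and summing over `l` for fixed `f` gives the other.
  have e : {p : (V → ZMod 2) × Module.Dual (ZMod 2) V //
      (IsQuad p.1 ∧ radCard p.1 * 4 ^ h = Nat.card V) ∧ charSum (p.1 + ⇑p.2) ≠ 0} ≃
      {f : V → ZMod 2 // (IsQuad f ∧ radCard f * 4 ^ h = Nat.card V) ∧ charSum f ≠ 0} ×
        Module.Dual (ZMod 2) V :=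
    { toFun := fun p => (⟨p.1.1 + ⇑p.1.2, by
        rw [isQuad_add_linear, radCard_add_linear]; exact p.2⟩, p.1.2)
      invFun := fun p => ⟨(p.1.1 + ⇑p.2, p.2), by
        have h2 : p.1.1 + ⇑p.2 + ⇑p.2 = p.1.1 := by
          ext x; simp only [Pi.add_apply, add_assoc, zmod_two_add_self, add_zero]
        simp only [isQuad_add_linear, radCard_add_linear, h2]
        exact p.1.2⟩
      left_inv := fun p => by
        ext x
        · simp only [Pi.add_apply, add_assoc, zmod_two_add_self, add_zero]
        · rfl
      right_inv := fun p => by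
        ext x
        · simp only [Pi.add_apply, add_assoc, zmod_two_add_self, add_zero]
        · rfl }
  have h1 := Nat.card_congr e
  rw [Nat.card_prod, card_dual, card_subtype_prod
    fun (f : V → ZMod 2) (l : Module.Dual (ZMod 2) V) => (IsQuad f ∧ radCard f * 4 ^ h = Nat.card V) ∧ charSum (f + ⇑l) ≠ 0] at h1
  rw [mul_comm, ← h1, quadCount, card_subtype_eq_sum, Finset.mul_sum]
  refine Finset.sum_congr rfl fun f _ => ?_
  by_cases hf : IsQuad f ∧ radCard f * 4 ^ h = Nat.card V
  · simp only [hf, and_self, true_and, if_true, mul_one]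
    refine Nat.eq_of_mul_eq_mul_right (radCard_pos f) ?_
    rw [card_charSum_ne_zero hf.1, mul_comm, hf.2]
  · simp only [hf, false_and, if_false, mul_zero, Nat.card_of_isEmpty]

variable {V} in
theorem radCard_mul_of_charSum_eq {f : V → ZMod 2} (hf : IsQuad f) {s : ℤ} {h : ℕ} (hs : s ≠ 0)
    (hsh : s ^ 2 * 4 ^ h = (Nat.card V : ℤ) ^ 2) (hfs : charSum f ^ 2 = s ^ 2) :
    radCard f * 4 ^ h = Nat.card V := by
  have h0 : charSum f ≠ 0 := by
    intro h0
    rw [h0, zero_pow two_ne_zero] at hfs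
    exact hs (pow_eq_zero_iff two_ne_zero |>.1 hfs.symm)
  have h1 := charSum_sq_of_ne_zero hf h0
  have hV : (Nat.card V : ℤ) ≠ 0 := by exact_mod_cast (Nat.card_pos (α := V)).ne'
  have h2 : (Nat.card V : ℤ) * (radCard f * 4 ^ h) = Nat.card V * Nat.card V := by
    rw [← mul_assoc, ← h1, hfs, hsh, sq]
  exact_mod_cast mul_left_cancel₀ hV h2

variable {V} in
theorem charSum_sq_eq_of_radCard {f : V → ZMod 2} (hf : IsQuad f) {s : ℤ} {h : ℕ}
    (hsh : s ^ 2 * 4 ^ h = (Nat.card V : ℤ) ^ 2) (hr : radCard f * 4 ^ h = Nat.card V)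
    (h0 : charSum f ≠ 0) : charSum f ^ 2 = s ^ 2 := by
  have hr' : (radCard f : ℤ) * 4 ^ h = Nat.card V := by exact_mod_cast hr
  refine mul_right_cancel₀ (pow_ne_zero h (four_ne_zero (α := ℤ))) ?_
  rw [charSum_sq_of_ne_zero hf h0, hsh, mul_assoc, hr', sq]

/-- The functions of rank `2 * h` with nonzero sum are exactly those with sum `s` or `-s`, and `f ↦
f + 1` exchanges the two classes; hence the factor `2`. -/
theorem two_mul_card_mul_charSumCount {s : ℤ} {h : ℕ} (hs : s ≠ 0)
    (hsh : s ^ 2 * 4 ^ h = (Nat.card V : ℤ) ^ 2) :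
    2 * Nat.card V * charSumCount V s = 4 ^ h * quadCount V h := by
  rw [← card_mul_card_charSum_ne_zero, ← card_subtype_add_not _ fun f => charSum f = s,
    mul_comm 2, mul_assoc]
  congr 1
  rw [two_mul]
  nth_rewrite 2 [← charSumCount_neg]
  congr 1 <;> refine Nat.card_congr (Equiv.subtypeEquivRight fun f => ⟨fun hf => ?_, fun hf => ?_⟩)
  · exact ⟨⟨⟨hf.1, radCard_mul_of_charSum_eq hf.1 hs hsh (by rw [hf.2])⟩, hf.2.trans_ne hs⟩, hf.2⟩
  · exact ⟨hf.1.1.1, hf.2⟩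
  · refine ⟨⟨⟨hf.1, radCard_mul_of_charSum_eq hf.1 hs hsh (by rw [hf.2, neg_sq])⟩, ?_⟩, ?_⟩ <;>
      rw [hf.2] <;> omega
  · exact ⟨hf.1.1.1, (sq_eq_sq_iff_eq_or_eq_neg.1
      (charSum_sq_eq_of_radCard hf.1.1.1 hsh hf.1.1.2 hf.1.2)).resolve_left hf.2⟩

theorem charSumCount_eq_zero {s : ℤ} (hs : s ≠ 0)
    (hsh : ∀ h : ℕ, s ^ 2 * 4 ^ h ≠ (Nat.card V : ℤ) ^ 2) : charSumCount V s = 0 := by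
  rw [charSumCount, Nat.card_eq_zero]
  left
  rw [isEmpty_subtype]
  rintro f ⟨hf, hfs⟩
  obtain ⟨h, hh⟩ := exists_radCard_mul_four_pow hf
  have hh' : (radCard f : ℤ) * 4 ^ h = Nat.card V := by exact_mod_cast hh
  refine hsh h ?_
  rw [← hfs, charSum_sq_of_ne_zero hf (hfs.trans_ne hs), mul_assoc, hh', sq]

/-- Within each rank the balanced functions are the complement of those with nonzero sum. The bound
on `K` ensures that every possible rank occurs in the range. -/
theorem card_mul_charSumCount_zero {K : ℕ} (hK : Nat.card V < 4 ^ K) :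
    (Nat.card V * charSumCount V 0 : ℤ) =
      ∑ h ∈ Finset.range K, ((Nat.card V : ℤ) - 4 ^ h) * quadCount V h := by
  have h1 : charSumCount V 0 = ∑ h ∈ Finset.range K, Nat.card {f : V → ZMod 2 //
      (IsQuad f ∧ charSum f = 0) ∧ radCard f * 4 ^ h = Nat.card V} := by
    refine card_subtype_eq_sum_range _ _ _ fun f hf => ?_
    obtain ⟨h, hh⟩ := exists_radCard_mul_four_pow hf.1
    have hr := radCard_pos f
    refine ⟨h, ⟨?_, hh⟩, fun k hk => ?_⟩
    · have : 4 ^ h ≤ Nat.card V := by rw [← hh]; exact Nat.le_mul_of_pos_left _ hr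
      exact (Nat.pow_lt_pow_iff_right (by norm_num)).1 (this.trans_lt hK)
    · exact Nat.pow_right_injective (by norm_num : 2 ≤ 4)
        (Nat.eq_of_mul_eq_mul_left hr (hk.2.trans hh.symm))
  rw [h1, Nat.cast_sum, Finset.mul_sum]
  refine Finset.sum_congr rfl fun h _ => ?_
  have h2 := card_mul_card_charSum_ne_zero V h
  have h3 := card_subtype_add_not
    (fun f : V → ZMod 2 => IsQuad f ∧ radCard f * 4 ^ h = Nat.card V) (fun f => charSum f = 0)
  have h4 : Nat.card {f : V → ZMod 2 //
      (IsQuad f ∧ charSum f = 0) ∧ radCard f * 4 ^ h = Nat.card V} = Nat.card {f : V → ZMod 2 //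
      (IsQuad f ∧ radCard f * 4 ^ h = Nat.card V) ∧ charSum f = 0} :=
    Nat.card_congr (Equiv.subtypeEquivRight fun f => by tauto)
  rw [h4]
  change _ = quadCount V h at h3
  replace h2 := congrArg (Nat.cast : ℕ → ℤ) h2
  replace h3 := congrArg (Nat.cast : ℕ → ℤ) h3
  rw [Nat.cast_mul, Nat.cast_mul, Nat.cast_pow, Nat.cast_ofNat] at h2
  rw [Nat.cast_add] at h3
  linear_combination (Nat.card V : ℤ) * h3 - h2

end CharacterSumDistribution

/-! ### Recurrence for the rank counts on adding one variable. -/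

section OneMoreVariable

variable {V : Type*} [AddCommGroup V]

theorem radical_add_mem {q : V → ZMod 2} (hq : IsQuad q) {x y : V} (hx : x ∈ radical q)
    (hy : y ∈ radical q) : x + y ∈ radical q := fun z => by rw [hq, hx, hy, add_zero]

theorem IsQuad.restrict {f : V × ZMod 2 → ZMod 2} (hf : IsQuad f) :
    IsQuad fun x => f (x, 0) := by
  intro x y z
  have := hf (x, 0) (y, 0) (z, 0)
  simpa only [polarFun, Prod.mk_add_mk, add_zero, ← Prod.mk_zero_zero] using this

variable [Module (ZMod 2) V]

/-- The function `q x + s * (l x + c)` on `V × 𝔽₂`. -/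
def extendFun (q : V → ZMod 2) (l : Module.Dual (ZMod 2) V) (c : ZMod 2) :
    V × ZMod 2 → ZMod 2 := fun p => q p.1 + p.2 * (l p.1 + c)

theorem polarFun_extendFun (q : V → ZMod 2) (l : Module.Dual (ZMod 2) V) (c : ZMod 2)
    (x y : V × ZMod 2) :
    polarFun (extendFun q l c) x y = polarFun q x.1 y.1 + x.2 * l y.1 + y.2 * l x.1 := by
  simp only [polarFun, extendFun, Prod.fst_add, Prod.snd_add, map_add, Prod.fst_zero,
    Prod.snd_zero, zero_mul, add_zero]
  linear_combination x.2 * zmod_two_add_self (l x.1) + y.2 * zmod_two_add_self (l y.1)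
    + x.2 * zmod_two_add_self c + y.2 * zmod_two_add_self c

theorem isQuad_extendFun {q : V → ZMod 2} (hq : IsQuad q) (l : Module.Dual (ZMod 2) V)
    (c : ZMod 2) : IsQuad (extendFun q l c) := by
  intro x y z
  simp only [polarFun_extendFun, Prod.fst_add, Prod.snd_add, map_add, hq x.1 y.1 z.1]
  ring

/-- A quadratic function on `V × 𝔽₂` amounts to a quadratic function and an affine function on
`V`. -/
def quadProdEquiv : {f : V × ZMod 2 → ZMod 2 // IsQuad f} ≃
    {q : V → ZMod 2 // IsQuad q} × (Module.Dual (ZMod 2) V × ZMod 2) where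
  toFun f := (⟨fun x => f.1 (x, 0), f.2.restrict⟩,
    (polarBilin f.2 (0, 1)) ∘ₗ LinearMap.inl (ZMod 2) V (ZMod 2), f.1 (0, 1) + f.1 (0, 0))
  invFun p := ⟨extendFun p.1.1 p.2.1 p.2.2, isQuad_extendFun p.1.2 _ _⟩
  left_inv f := by
    ext ⟨x, s⟩
    simp only [extendFun, LinearMap.comp_apply, LinearMap.inl_apply, polarBilin_apply, polarFun,
      Prod.mk_add_mk, zero_add, add_zero]
    -- A function of the bit `s` is determined by its values at `0` and `1`, so no term in `s ^ 2`
    -- is needed.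
    have hs : s = 0 ∨ s = 1 := by revert s; decide
    rcases hs with rfl | rfl
    · simp
    · have h0 : (0 : V × ZMod 2) = (0, 0) := rfl
      rw [h0]
      linear_combination zmod_two_add_self (f.1 (x, 0)) + zmod_two_add_self (f.1 (0, 1))
        + zmod_two_add_self (f.1 (0, 0))
  right_inv p := by
    refine Prod.ext ?_ (Prod.ext ?_ ?_)
    · ext x
      simp [extendFun]
    · ext x
      simp only [LinearMap.comp_apply, LinearMap.inl_apply, polarBilin_apply, polarFun_extendFun,
        polarFun_zero_left]
      simp
    · simp only [extendFun, map_zero]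
      linear_combination zmod_two_add_self (p.1.1 0)

theorem mem_radical_extendFun {q : V → ZMod 2} {l : Module.Dual (ZMod 2) V} {c : ZMod 2}
    {p : V × ZMod 2} :
    p ∈ radical (extendFun q l c) ↔ (∀ y, polarFun q p.1 y + p.2 * l y = 0) ∧ l p.1 = 0 := by
  constructor
  · intro h
    refine ⟨fun y => ?_, ?_⟩
    · simpa [polarFun_extendFun] using h (y, 0)
    · have := h (0, 1)
      rw [polarFun_extendFun, polarFun_comm, polarFun_zero_left] at this
      simpa using this
  · rintro ⟨h1, h2⟩ y
    rw [polarFun_extendFun, h1, h2, mul_zero, add_zero]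

theorem radical_smul_mem {q : V → ZMod 2} (hq : IsQuad q) (a : ZMod 2) {x : V}
    (hx : x ∈ radical q) : a • x ∈ radical q :=
  (mem_ker_polarBilin hq _).1 (Submodule.smul_mem _ a ((mem_ker_polarBilin hq _).2 hx))

theorem polarFun_smul {q : V → ZMod 2} (hq : IsQuad q) (a : ZMod 2) (x y : V) :
    polarFun q (a • x) y = a * polarFun q x y := by
  rw [← polarBilin_apply hq, map_smul]; rfl

theorem polarFun_add_smul {q : V → ZMod 2} (hq : IsQuad q) (x z : V) (a : ZMod 2) (y : V) :
    polarFun q (x + a • z) y = polarFun q x y + a * polarFun q z y := by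
  rw [hq, polarFun_smul hq]

theorem add_smul_add_smul (x z : V) (a : ZMod 2) : x + a • z + a • z = x := by
  rw [add_assoc, module_add_self, add_zero]

/-- Here `l` is the polar form against some `z`, and the shear `(x, s) ↦ (x + s • z, s)` carries the
new radical onto the old one times `𝔽₂`. The rank is unchanged. -/
theorem radCard_extendFun_of_vanish [Finite V] {q : V → ZMod 2} (hq : IsQuad q)
    {l : Module.Dual (ZMod 2) V} (c : ZMod 2) (hl : ∀ x ∈ radical q, l x = 0) :
    radCard (extendFun q l c) = 2 * radCard q := by
  obtain ⟨z, rfl⟩ := exists_polarBilin_eq hq l hl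
  have e : radical (extendFun q (polarBilin hq z) c) ≃ ZMod 2 × radical q :=
    { toFun := fun p => (p.1.2, ⟨p.1.1 + p.1.2 • z, fun y => by
        rw [polarFun_add_smul hq]; exact (mem_radical_extendFun.1 p.2).1 y⟩)
      invFun := fun p => ⟨(p.2.1 + p.1 • z, p.1), mem_radical_extendFun.2 ⟨fun y => by
        rw [polarFun_add_smul hq, p.2.2 y, zero_add]; exact zmod_two_add_self _, by
        rw [polarBilin_apply, polarFun_comm, polarFun_add_smul hq, p.2.2, polarFun_self,
          mul_zero, add_zero]⟩⟩
      left_inv := fun p => by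
        ext
        · exact add_smul_add_smul _ _ _
        · rfl
      right_inv := fun p => by
        ext
        · rfl
        · exact add_smul_add_smul _ _ _ }
  rw [radCard, Nat.card_congr e, Nat.card_prod, Nat.card_zmod, radCard]

/-- The new radical lies in `s = 0` and is the kernel of `l` on the old radical, of index two; `w`
spans a complement. The rank goes up by two. -/
theorem radCard_extendFun_of_not_vanish {q : V → ZMod 2} (hq : IsQuad q)
    {l : Module.Dual (ZMod 2) V} (c : ZMod 2) (hl : ¬ ∀ x ∈ radical q, l x = 0) :
    2 * radCard (extendFun q l c) = radCard q := by
  push Not at hl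
  obtain ⟨w, hw, hlw⟩ := hl
  have one_of_ne : ∀ a : ZMod 2, a ≠ 0 → a = 1 := by decide
  have hlw1 := one_of_ne _ hlw
  have hsnd : ∀ p ∈ radical (extendFun q l c), p.2 = 0 := by
    intro p hp
    by_contra hne
    have h1 := (mem_radical_extendFun.1 hp).1 w
    rw [polarFun_comm, hw, one_of_ne _ hne, hlw1] at h1
    simp at h1
  have e : radical q ≃ ZMod 2 × radical (extendFun q l c) :=
    { toFun := fun x => (l x.1, ⟨(x.1 + l x.1 • w, 0), mem_radical_extendFun.2 ⟨fun y => by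
        rw [radical_add_mem hq x.2 (radical_smul_mem hq _ hw), zero_mul, add_zero], by
        simp only [map_add, map_smul, hlw1, smul_eq_mul, mul_one, zmod_two_add_self]⟩⟩)
      invFun := fun p => ⟨p.2.1.1 + p.1 • w, radical_add_mem hq (fun y => by
        have := (mem_radical_extendFun.1 p.2.2).1 y
        rwa [hsnd _ p.2.2, zero_mul, add_zero] at this) (radical_smul_mem hq _ hw)⟩
      left_inv := fun x => by
        ext
        exact add_smul_add_smul _ _ _
      right_inv := fun p => by
        have h1 : l (p.2.1.1 + p.1 • w) = p.1 := by
          rw [map_add, map_smul, (mem_radical_extendFun.1 p.2.2).2, hlw1, smul_eq_mul, mul_one,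
            zero_add]
        ext
        · exact h1
        · simp only [h1]
          exact add_smul_add_smul _ _ _
        · exact (hsnd _ p.2.2).symm }
  rw [radCard, radCard, Nat.card_congr e, Nat.card_prod, Nat.card_zmod]

theorem card_vanish_mul_radCard [Finite V] {q : V → ZMod 2} (hq : IsQuad q) :
    Nat.card {l : Module.Dual (ZMod 2) V // ∀ x ∈ radical q, l x = 0} * radCard q =
      Nat.card V := by
  rw [← card_ker_polarBilin hq, ← card_extensions (LinearMap.ker (polarBilin hq)) 0]
  congr 1
  refine Nat.card_congr (Equiv.subtypeEquivRight fun l => ?_)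
  exact ⟨fun h x => h x ((mem_ker_polarBilin hq x).1 x.2),
    fun h x hx => h ⟨x, (mem_ker_polarBilin hq x).2 hx⟩⟩

/-- The number of extensions of a quadratic function with a prescribed order of the radical. -/
theorem card_extendFun [Finite V] (q : V → ZMod 2) (N : ℕ) :
    Nat.card {p : Module.Dual (ZMod 2) V × ZMod 2 //
      IsQuad q ∧ radCard (extendFun q p.1 p.2) * N = 2 * Nat.card V} =
    2 * (Nat.card {l : Module.Dual (ZMod 2) V //
        (IsQuad q ∧ radCard q * N = Nat.card V) ∧ ∀ x ∈ radical q, l x = 0} +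
      Nat.card {l : Module.Dual (ZMod 2) V //
        (IsQuad q ∧ radCard q * N = 4 * Nat.card V) ∧ ¬ ∀ x ∈ radical q, l x = 0}) := by
  classical
  have : Finite (Module.Dual (ZMod 2) V) := DFunLike.finite _
  have := Fintype.ofFinite (Module.Dual (ZMod 2) V)
  rw [card_subtype_prod fun (l : Module.Dual (ZMod 2) V) c =>
    IsQuad q ∧ radCard (extendFun q l c) * N = 2 * Nat.card V]
  simp only [card_subtype_eq_sum, ← Finset.sum_add_distrib, Finset.mul_sum]
  refine Finset.sum_congr rfl fun l _ => ?_
  by_cases hq : IsQuad q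
  swap
  · simp [hq]
  by_cases hl : ∀ x ∈ radical q, l x = 0
  · have h1 : ∀ c, radCard (extendFun q l c) * N = 2 * Nat.card V ↔ radCard q * N = Nat.card V := by
      intro c
      rw [radCard_extendFun_of_vanish hq c hl, mul_assoc]
      omega
    simp only [eq_true hl, hq, h1, true_and, and_true, not_true_eq_false, and_false, if_false,
      add_zero, Finset.sum_const, Finset.card_univ, ZMod.card, smul_eq_mul]
  · have h1 : ∀ c, radCard (extendFun q l c) * N = 2 * Nat.card V ↔
        radCard q * N = 4 * Nat.card V := by
      intro c
      rw [← radCard_extendFun_of_not_vanish hq c hl, mul_assoc]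
      omega
    simp only [hq, hl, h1, true_and, and_true, not_false_eq_true, and_false, if_false, zero_add,
      Finset.sum_const, Finset.card_univ, ZMod.card, smul_eq_mul]

theorem quadCount_prod_eq_sum [Fintype V] [DecidableEq V] (h : ℕ) :
    quadCount (V × ZMod 2) h = ∑ q : V → ZMod 2, Nat.card {p : Module.Dual (ZMod 2) V × ZMod 2 //
      IsQuad q ∧ radCard (extendFun q p.1 p.2) * 4 ^ h = 2 * Nat.card V} := by
  have : Finite (Module.Dual (ZMod 2) V) := DFunLike.finite _
  rw [← card_subtype_prod fun (q : V → ZMod 2) (p : Module.Dual (ZMod 2) V × ZMod 2) =>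
    IsQuad q ∧ radCard (extendFun q p.1 p.2) * 4 ^ h = 2 * Nat.card V]
  rw [quadCount, Nat.card_prod, Nat.card_zmod, mul_comm (Nat.card V)]
  have e : {p : {q : V → ZMod 2 // IsQuad q} × (Module.Dual (ZMod 2) V × ZMod 2) //
        radCard (extendFun p.1.1 p.2.1 p.2.2) * 4 ^ h = 2 * Nat.card V} ≃
      {p : (V → ZMod 2) × (Module.Dual (ZMod 2) V × ZMod 2) //
        IsQuad p.1 ∧ radCard (extendFun p.1 p.2.1 p.2.2) * 4 ^ h = 2 * Nat.card V} :=
    { toFun := fun p => ⟨(p.1.1.1, p.1.2), p.1.1.2, p.2⟩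
      invFun := fun p => ⟨(⟨p.1.1, p.2.1⟩, p.1.2), p.2.2⟩
      left_inv := fun _ => rfl
      right_inv := fun _ => rfl }
  exact Nat.card_congr ((Equiv.subtypeSubtypeEquivSubtypeInter IsQuad
    fun f : V × ZMod 2 → ZMod 2 => radCard f * 4 ^ h = 2 * Nat.card V).symm.trans
      ((Equiv.subtypeEquiv quadProdEquiv.symm fun _ => Iff.rfl).symm.trans e))

theorem sum_card_vanish [Fintype V] [DecidableEq V] (h : ℕ) :
    ∑ q : V → ZMod 2, Nat.card {l : Module.Dual (ZMod 2) V //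
        (IsQuad q ∧ radCard q * 4 ^ h = Nat.card V) ∧ ∀ x ∈ radical q, l x = 0} =
      4 ^ h * quadCount V h := by
  classical
  rw [quadCount, card_subtype_eq_sum, Finset.mul_sum]
  refine Finset.sum_congr rfl fun q _ => ?_
  by_cases hq : IsQuad q ∧ radCard q * 4 ^ h = Nat.card V
  · simp only [hq, and_self, true_and, if_true, mul_one]
    refine Nat.eq_of_mul_eq_mul_right (radCard_pos q) ?_
    rw [card_vanish_mul_radCard hq.1, mul_comm, hq.2]
  · simp only [hq, false_and, if_false, mul_zero, Nat.card_of_isEmpty]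

theorem sum_card_not_vanish [Fintype V] [DecidableEq V] (h : ℕ) :
    (∑ q : V → ZMod 2, Nat.card {l : Module.Dual (ZMod 2) V //
        (IsQuad q ∧ radCard q * 4 ^ h = Nat.card V) ∧ ¬ ∀ x ∈ radical q, l x = 0} : ℕ) =
      ((Nat.card V : ℤ) - 4 ^ h) * quadCount V h := by
  classical
  have : Finite (Module.Dual (ZMod 2) V) := DFunLike.finite _
  have h1 : ∑ q : V → ZMod 2, Nat.card {l : Module.Dual (ZMod 2) V //
      IsQuad q ∧ radCard q * 4 ^ h = Nat.card V} = Nat.card V * quadCount V h := by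
    rw [quadCount, card_subtype_eq_sum, Finset.mul_sum]
    refine Finset.sum_congr rfl fun q _ => ?_
    by_cases hq : IsQuad q ∧ radCard q * 4 ^ h = Nat.card V
    · simp only [hq, and_self, if_true, mul_one]
      rw [← card_dual (V := V)]
      exact Nat.card_congr (Equiv.subtypeUnivEquiv fun _ => trivial)
    · simp only [hq, if_false, mul_zero, Nat.card_of_isEmpty]
  have h2 := sum_card_vanish (V := V) h
  have h3 := Finset.sum_congr rfl fun (q : V → ZMod 2) (_ : q ∈ Finset.univ) =>
    card_subtype_add_not (fun _ : Module.Dual (ZMod 2) V =>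
      IsQuad q ∧ radCard q * 4 ^ h = Nat.card V) (fun l => ∀ x ∈ radical q, l x = 0)
  rw [Finset.sum_add_distrib, h1, h2] at h3
  replace h3 := congrArg (Nat.cast : ℕ → ℤ) h3
  rw [Nat.cast_add, Nat.cast_mul, Nat.cast_mul, Nat.cast_pow, Nat.cast_ofNat] at h3
  linear_combination h3

/-- Rank `2 * (h + 1)` arises either from the same rank, with `4 ^ (h + 1)` linear forms vanishing
on the radical, or from rank `2 * h`, with the `|V| - 4 ^ h` forms that do not. The factor `2` is
the free constant `c`. -/
theorem quadCount_prod_succ [Fintype V] (h : ℕ) :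
    (quadCount (V × ZMod 2) (h + 1) : ℤ) = 2 * (4 ^ (h + 1) * quadCount V (h + 1) +
      ((Nat.card V : ℤ) - 4 ^ h) * quadCount V h) := by
  classical
  rw [quadCount_prod_eq_sum]
  simp only [card_extendFun]
  rw [← Finset.mul_sum, Finset.sum_add_distrib, sum_card_vanish]
  have h1 : ∀ q : V → ZMod 2, radCard q * 4 ^ (h + 1) = 4 * Nat.card V ↔
      radCard q * 4 ^ h = Nat.card V := fun q => by rw [pow_succ, ← mul_assoc]; omega
  simp only [h1]
  rw [Nat.cast_mul, Nat.cast_add, sum_card_not_vanish]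
  push_cast
  ring

theorem quadCount_prod_zero [Fintype V] :
    quadCount (V × ZMod 2) 0 = 2 * quadCount V 0 := by
  classical
  rw [quadCount_prod_eq_sum]
  simp only [card_extendFun]
  rw [← Finset.mul_sum, Finset.sum_add_distrib, sum_card_vanish]
  have h1 : ∀ q : V → ZMod 2, ¬ radCard q * 4 ^ 0 = 4 * Nat.card V := fun q => by
    have h2 : radCard q ≤ Nat.card V := Finite.card_subtype_le _
    have h3 : 0 < Nat.card V := Nat.card_pos
    omega
  simp only [h1, and_false, false_and, Nat.card_of_isEmpty, Finset.sum_const_zero, add_zero]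
  rw [pow_zero, one_mul]

end OneMoreVariable

/-! ### Invariance under additive isomorphisms. -/

section Transport

variable {V W : Type*} [AddCommGroup V] [AddCommGroup W]

theorem polarFun_comp (e : V ≃+ W) (f : W → ZMod 2) (x y : V) :
    polarFun (f ∘ e) x y = polarFun f (e x) (e y) := by
  simp only [polarFun, Function.comp_apply, map_add, map_zero]

theorem isQuad_comp (e : V ≃+ W) {f : W → ZMod 2} : IsQuad (f ∘ e) ↔ IsQuad f := by
  simp only [IsQuad, polarFun_comp, map_add, e.surjective.forall]

theorem radCard_comp (e : V ≃+ W) (f : W → ZMod 2) : radCard (f ∘ e) = radCard f :=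
  Nat.card_congr (e.toEquiv.subtypeEquiv fun x => by
    change (∀ y, _ = _) ↔ (∀ y, _ = _)
    simp only [polarFun_comp, e.surjective.forall]
    rfl)

theorem quadCount_congr (e : V ≃+ W) (h : ℕ) : quadCount V h = quadCount W h := by
  refine (Nat.card_congr ((e.toEquiv.arrowCongr (Equiv.refl (ZMod 2))).symm.subtypeEquiv
    fun f => ?_)).symm
  change _ ↔ IsQuad (f ∘ e) ∧ radCard (f ∘ e) * 4 ^ h = _
  rw [isQuad_comp, radCard_comp, Nat.card_congr e.toEquiv]

end Transport

/-- Splitting off the first coordinate. -/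
def consAddEquiv (m : ℕ) : (Fin m → ZMod 2) × ZMod 2 ≃+ (Fin (m + 1) → ZMod 2) where
  toFun p := Fin.cons p.2 p.1
  invFun x := (Fin.tail x, x 0)
  left_inv p := by simp
  right_inv x := by simp
  map_add' p q := by
    ext i
    refine Fin.cases ?_ (fun j => ?_) i <;> simp

/-! ### The second order Reed–Muller code as the space of quadratic functions. -/

section ReedMuller

open MvPolynomial

/-- The quadratic functions as a subspace. -/
def quadSubmodule (V : Type*) [AddCommGroup V] : Submodule (ZMod 2) (V → ZMod 2) where
  carrier := {f | IsQuad f}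
  zero_mem' := fun x y z => by simp [polarFun]
  add_mem' := fun {f g} hf hg x y z => by
    rw [polarFun_add, polarFun_add, polarFun_add, hf, hg]; ring
  smul_mem' := fun c f hf x y z => by
    have h : ∀ u v, polarFun (c • f) u v = c * polarFun f u v := fun u v => by
      simp only [polarFun, Pi.smul_apply, smul_eq_mul]; ring
    rw [h, h, h, hf]; ring

theorem isQuad_monomial {m : ℕ} (n : Fin m →₀ ℕ) (hn : n.degree ≤ 2) (c : ZMod 2) :
    IsQuad fun x : Fin m → ZMod 2 => eval x (monomial n c) := by
  have h1 : (fun x : Fin m → ZMod 2 => eval x (monomial n c)) =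
      c • fun x : Fin m → ZMod 2 => ((Finsupp.toMultiset n).map x).prod := by
    ext x
    rw [eval_monomial, Pi.smul_apply, Finsupp.toMultiset_map, Finsupp.prod_toMultiset,
      Finsupp.prod_mapDomain_index (fun _ => pow_zero _) fun _ _ _ => pow_add _ _ _, smul_eq_mul]
  rw [h1]
  refine (quadSubmodule (Fin m → ZMod 2)).smul_mem c ?_
  -- As a multiset of variables the monomial has at most two entries, possibly equal, so squares
  -- need no separate case.
  have h2 : Multiset.card (Finsupp.toMultiset n) ≤ 2 := by
    rw [Finsupp.card_toMultiset]; exact hn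
  generalize Finsupp.toMultiset n = s at h2
  change IsQuad _
  interval_cases hs : Multiset.card s
  · rw [Multiset.card_eq_zero.1 hs]
    intro x y z
    simp only [polarFun, Multiset.map_zero, Multiset.prod_zero]
    decide
  · obtain ⟨i, rfl⟩ := Multiset.card_eq_one.1 hs
    intro x y z
    simp only [polarFun, Multiset.map_singleton, Multiset.prod_singleton, Pi.add_apply,
      Pi.zero_apply]
    linear_combination -zmod_two_add_self (z i)
  · obtain ⟨i, j, rfl⟩ := Multiset.card_eq_two.1 hs
    intro x y z
    simp only [polarFun, Multiset.insert_eq_cons, Multiset.map_cons, Multiset.map_singleton,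
      Multiset.prod_cons, Multiset.prod_singleton, Pi.add_apply, Pi.zero_apply]
    linear_combination zmod_two_add_self (x i * y j) + zmod_two_add_self (y i * x j) -
      zmod_two_add_self (z i * z j)

theorem isQuad_of_mem_reedMuller {m : ℕ} {f : (Fin m → ZMod 2) → ZMod 2}
    (hf : f ∈ reedMuller 2 m) : IsQuad f := by
  obtain ⟨p, hp, rfl⟩ := hf
  have hp' := (mem_restrictTotalDegree _ _ _).1 hp
  have h1 : evalₗ (ZMod 2) (Fin m) p =
      ∑ n ∈ p.support, fun x => eval x (monomial n (coeff n p)) := by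
    ext x
    rw [evalₗ_apply, Finset.sum_apply, ← map_sum, support_sum_monomial_coeff]
  rw [h1]
  refine (quadSubmodule (Fin m → ZMod 2)).sum_mem fun n hn => ?_
  refine isQuad_monomial n (le_trans ?_ hp') _
  exact le_totalDegree hn

/-- Induction on the number of variables: `quadProdEquiv` splits off the first one, and `q x + s *
(l x + c)` is visibly a polynomial of degree at most two. -/
theorem mem_reedMuller_of_isQuad : ∀ {m : ℕ} {f : (Fin m → ZMod 2) → ZMod 2},
    IsQuad f → f ∈ reedMuller 2 m := by
  intro m
  induction m with
  | zero =>
    intro f _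
    refine ⟨C (f 0), (mem_restrictTotalDegree _ _ _).2 (by simp), ?_⟩
    ext x
    rw [evalₗ_apply, eval_C, Subsingleton.elim x 0]
  | succ m ih =>
    intro f hf
    have hf' := (isQuad_comp (consAddEquiv m)).2 hf
    obtain ⟨⟨⟨q, hq⟩, l, c⟩, hp⟩ := quadProdEquiv.symm.surjective ⟨_, hf'⟩
    have hp' : extendFun q l c = f ∘ consAddEquiv m := congrArg Subtype.val hp
    obtain ⟨P, hP, rfl⟩ := ih hq
    have hP' := (mem_restrictTotalDegree _ _ _).1 hP
    refine ⟨rename Fin.succ P +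
      X 0 * (∑ i : Fin m, C (l (Pi.single i 1)) * X i.succ + C c), ?_, ?_⟩
    · refine (mem_restrictTotalDegree _ _ _).2 ((totalDegree_add _ _).trans (max_le ?_ ?_))
      · exact (totalDegree_rename_le _ _).trans hP'
      · refine (totalDegree_mul _ _).trans ?_
        rw [totalDegree_X]
        refine (Nat.add_le_add_left ?_ 1 : _ ≤ 1 + 1)
        refine (totalDegree_add _ _).trans (max_le ?_ (by simp))
        refine (totalDegree_finsetSum _ _).trans (Finset.sup_le fun i _ => ?_)
        exact (totalDegree_mul _ _).trans (by rw [totalDegree_C, totalDegree_X])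
    · ext x
      obtain ⟨⟨y, s⟩, rfl⟩ := (consAddEquiv m).surjective x
      have h1 := congrFun hp' (y, s)
      rw [Function.comp_apply] at h1
      rw [← h1]
      have hs : consAddEquiv m (y, s) ∘ Fin.succ = y := by ext i; rfl
      have h0 : consAddEquiv m (y, s) 0 = s := rfl
      have hi : ∀ i : Fin m, consAddEquiv m (y, s) i.succ = y i := fun i => rfl
      have hl : l y = ∑ i, l (Pi.single i 1) * y i := by
        conv_lhs => rw [pi_eq_sum_univ' y]
        rw [map_sum]
        refine Finset.sum_congr rfl fun i _ => ?_
        rw [map_smul, smul_eq_mul, mul_comm]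
      simp only [evalₗ_apply, map_add, map_mul, map_sum, eval_rename, eval_X, eval_C, hs, h0, hi,
        extendFun, hl]

/-- The second order Reed–Muller code consists of the quadratic functions. -/
theorem mem_reedMuller_two_iff {m : ℕ} {f : (Fin m → ZMod 2) → ZMod 2} :
    f ∈ reedMuller 2 m ↔ IsQuad f :=
  ⟨isQuad_of_mem_reedMuller, mem_reedMuller_of_isQuad⟩

theorem weightDist_reedMuller_two (m i : ℕ) :
    weightDist (reedMuller 2 m) i = charSumCount (Fin m → ZMod 2) (2 ^ m - 2 * i) := by
  rw [weightDist, ← Nat.card_coe_set_eq]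
  refine Nat.card_congr (Equiv.subtypeEquivRight fun f => ?_)
  rw [Set.mem_ofPred_eq, mem_reedMuller_two_iff, charSum_eq_card_sub]
  refine and_congr_right fun _ => ?_
  simp only [Fintype.card_pi, ZMod.card, Finset.prod_const, Finset.card_univ, Fintype.card_fin]
  push_cast
  omega

end ReedMuller

/-! ### Closed form for ratios of consecutive rank counts. -/

section Ratio

/-- The number of quadratic functions in `m` variables with polar form of rank `2 * h`. -/
noncomputable def rankCount (m h : ℕ) : ℕ := quadCount (Fin m → ZMod 2) h

theorem natCard_cube (m : ℕ) : Nat.card (Fin m → ZMod 2) = 2 ^ m := by simp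

theorem rankCount_succ_succ (m h : ℕ) :
    (rankCount (m + 1) (h + 1) : ℤ) = 2 * (4 ^ (h + 1) * rankCount m (h + 1) +
      ((2 : ℤ) ^ m - 4 ^ h) * rankCount m h) := by
  rw [rankCount, ← quadCount_congr (consAddEquiv m), quadCount_prod_succ, natCard_cube]
  push_cast
  rfl

theorem rankCount_succ_zero (m : ℕ) : rankCount (m + 1) 0 = 2 * rankCount m 0 := by
  rw [rankCount, ← quadCount_congr (consAddEquiv m), quadCount_prod_zero]
  rfl

theorem rankCount_eq_zero {m h : ℕ} (hmh : m < 2 * h) : rankCount m h = 0 := by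
  rw [rankCount, quadCount, Nat.card_eq_zero]
  left
  rw [isEmpty_subtype]
  rintro f ⟨-, hf⟩
  have h1 : 4 ^ h ≤ 2 ^ m := by
    rw [← natCard_cube, ← hf]; exact Nat.le_mul_of_pos_left _ (radCard_pos f)
  rw [show 4 = 2 ^ 2 from rfl, ← pow_mul, Nat.pow_le_pow_iff_right (by norm_num)] at h1
  omega

theorem rankCount_zero_zero : 0 < rankCount 0 0 := by
  have : Nonempty {f : (Fin 0 → ZMod 2) → ZMod 2 //
      IsQuad f ∧ radCard f * 4 ^ 0 = Nat.card (Fin 0 → ZMod 2)} := by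
    refine ⟨0, (quadSubmodule _).zero_mem, ?_⟩
    have h1 := radCard_pos (0 : (Fin 0 → ZMod 2) → ZMod 2)
    have h2 : radCard (0 : (Fin 0 → ZMod 2) → ZMod 2) ≤ Nat.card (Fin 0 → ZMod 2) :=
      Finite.card_subtype_le _
    rw [natCard_cube] at h2 ⊢
    omega
  exact Nat.card_pos

theorem rankCount_zero_pos (m : ℕ) : 0 < rankCount m 0 := by
  induction m with
  | zero => exact rankCount_zero_zero
  | succ m ih => rw [rankCount_succ_zero]; omega

/-- The ratio of consecutive rank counts. -/
theorem rankCount_ratio (m : ℕ) : ∀ h : ℕ,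
    2 * (4 : ℤ) ^ h * (4 * 4 ^ h - 1) * rankCount m (h + 1) =
      (2 ^ m - 4 ^ h) * (2 ^ m - 2 * 4 ^ h) * rankCount m h := by
  induction m with
  | zero =>
    intro h
    rw [rankCount_eq_zero (h := h + 1) (by omega)]
    rcases h with _ | h
    · simp
    · rw [rankCount_eq_zero (h := h + 1) (by omega)]; simp
  | succ m ih =>
    intro h
    rcases h with _ | h
    · have h1 := ih 0
      rw [rankCount_succ_succ, rankCount_succ_zero]
      push_cast
      simp only [pow_succ, pow_zero] at h1 ⊢
      linear_combination 8 * h1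
    · have h1 := ih h
      have h2 := ih (h + 1)
      rw [rankCount_succ_succ, rankCount_succ_succ]
      simp only [pow_succ] at h1 h2 ⊢
      generalize (4 : ℤ) ^ h = u at *
      generalize (2 : ℤ) ^ m = x at *
      -- With `u = 4 ^ h` and `x = 2 ^ m`, the recurrence reduces the claim to a polynomial
      -- combination of the induction hypotheses at `h + 1` and `h`.
      linear_combination 32 * u * h2 + 8 * (x - 4 * u) * h1

end Ratio

/-! ### Inequalities between rank counts. -/

section Inequalities

theorem four_pow_le_two_pow {m h : ℕ} (hmh : 2 * h ≤ m) : (4 : ℤ) ^ h ≤ 2 ^ m := by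
  rw [show (4 : ℤ) = 2 ^ 2 by norm_num, ← pow_mul]
  exact pow_le_pow_right₀ (by norm_num) hmh

theorem rankCount_pos {m h : ℕ} (hmh : 2 * h ≤ m) : 0 < rankCount m h := by
  induction h with
  | zero => exact rankCount_zero_pos m
  | succ h ih =>
    have h1 := rankCount_ratio m h
    have hx := four_pow_le_two_pow hmh
    rw [pow_succ] at hx
    have ht : (1 : ℤ) ≤ 4 ^ h := one_le_pow₀ (by norm_num)
    have hM : (0 : ℤ) < rankCount m h := by exact_mod_cast ih (by omega)
    by_contra hne
    have h0 : rankCount m (h + 1) = 0 := by omega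
    have h2 : (0 : ℤ) < (2 ^ m - 4 ^ h) * (2 ^ m - 2 * 4 ^ h) * rankCount m h :=
      mul_pos (mul_pos (by linarith) (by linarith)) hM
    rw [← h1, h0] at h2
    simp at h2

theorem rankCount_le_four_mul {m h : ℕ} (hmh : 2 * (h + 1) ≤ m) :
    (rankCount m h : ℤ) ≤ 4 * rankCount m (h + 1) := by
  have h1 := rankCount_ratio m h
  have hx := four_pow_le_two_pow hmh
  have ht : (1 : ℤ) ≤ 4 ^ h := one_le_pow₀ (by norm_num)
  rw [pow_succ] at hx
  generalize (4 : ℤ) ^ h = t at *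
  generalize (2 : ℤ) ^ m = x at *
  have hD : 0 < 2 * t * (4 * t - 1) := mul_pos (by linarith) (by linarith)
  have hE : 2 * t * (4 * t - 1) ≤ 4 * ((x - t) * (x - 2 * t)) := by nlinarith
  have hM : (0 : ℤ) ≤ rankCount m h := Nat.cast_nonneg _
  refine le_of_mul_le_mul_left ?_ hD
  calc 2 * t * (4 * t - 1) * rankCount m h
      ≤ 4 * ((x - t) * (x - 2 * t)) * rankCount m h := mul_le_mul_of_nonneg_right hE hM
    _ = 2 * t * (4 * t - 1) * (4 * rankCount m (h + 1)) := by linear_combination -4 * h1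

/-- With `t = 4 ^ h` and `2 ^ m ≥ 16 * t`, the numerator of the ratio is at least `15 * 14 * t ^ 2 =
210 * t ^ 2`, while the denominator is below `8 * t ^ 2`; and `26 * 8 = 208`. -/
theorem rankCount_mul_le {m h : ℕ} (hmh : 2 * (h + 2) ≤ m) :
    26 * (rankCount m h : ℤ) ≤ rankCount m (h + 1) := by
  have h1 := rankCount_ratio m h
  have hx := four_pow_le_two_pow hmh
  have ht : (1 : ℤ) ≤ 4 ^ h := one_le_pow₀ (by norm_num)
  rw [pow_add] at hx
  generalize (4 : ℤ) ^ h = t at *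
  generalize (2 : ℤ) ^ m = x at *
  have hD : 0 < 2 * t * (4 * t - 1) := mul_pos (by linarith) (by linarith)
  have hE : 26 * (2 * t * (4 * t - 1)) ≤ (x - t) * (x - 2 * t) := by nlinarith
  have hM : (0 : ℤ) ≤ rankCount m h := Nat.cast_nonneg _
  refine le_of_mul_le_mul_left ?_ hD
  calc 2 * t * (4 * t - 1) * (26 * rankCount m h)
      = 26 * (2 * t * (4 * t - 1)) * rankCount m h := by ring
    _ ≤ (x - t) * (x - 2 * t) * rankCount m h := mul_le_mul_of_nonneg_right hE hM
    _ = 2 * t * (4 * t - 1) * rankCount m (h + 1) := h1.symm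

/-- The ratio of consecutive counts is `E / D`, and passing from `h` to `h + 1` increases `D` and
decreases `E`. -/
theorem rankCount_logConcave {m h : ℕ} (hmh : 2 * (h + 2) ≤ m) :
    (rankCount m h : ℤ) * rankCount m (h + 2) ≤ rankCount m (h + 1) ^ 2 := by
  have h1 := rankCount_ratio m h
  have h2 := rankCount_ratio m (h + 1)
  have hx := four_pow_le_two_pow hmh
  have ht : (1 : ℤ) ≤ 4 ^ h := one_le_pow₀ (by norm_num)
  rw [pow_add] at hx
  rw [pow_succ, show h + 1 + 1 = h + 2 from rfl] at h2
  generalize (4 : ℤ) ^ h = t at *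
  generalize (2 : ℤ) ^ m = x at *
  generalize (rankCount m h : ℤ) = M₀ at *
  generalize (rankCount m (h + 1) : ℤ) = M₁ at *
  generalize (rankCount m (h + 2) : ℤ) = M₂ at *
  set D₁ := 2 * t * (4 * t - 1) with hD₁
  set E₁ := (x - t) * (x - 2 * t) with hE₁
  set D₂ := 2 * (t * 4) * (4 * (t * 4) - 1) with hD₂
  set E₂ := (x - t * 4) * (x - 2 * (t * 4)) with hE₂
  have hD₁0 : 0 < D₁ := mul_pos (by linarith) (by linarith)
  have hE₁0 : 0 < E₁ := mul_pos (by linarith) (by linarith)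
  have hD : D₁ ≤ D₂ := by nlinarith
  have hE : E₂ ≤ E₁ := by nlinarith
  have hE₂0 : 0 ≤ E₂ := mul_nonneg (by linarith) (by linarith)
  refine le_of_mul_le_mul_left (a := D₂ * E₁) ?_ (mul_pos (by linarith) hE₁0)
  calc D₂ * E₁ * (M₀ * M₂) = D₁ * E₂ * M₁ ^ 2 := by
        linear_combination E₁ * M₀ * h2 - E₂ * M₁ * h1
    _ ≤ D₂ * E₁ * M₁ ^ 2 :=
        mul_le_mul_of_nonneg_right (mul_le_mul hD hE hE₂0 (by linarith)) (sq_nonneg _)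

/-- The growth factor `26 = 25 + 1` makes the constant `25` reproduce itself in the induction. -/
theorem sum_rankCount_le {m k : ℕ} (hmk : 2 * (k + 1) ≤ m) :
    25 * ∑ h ∈ Finset.range k, (rankCount m h : ℤ) ≤ rankCount m k := by
  induction k with
  | zero => simp
  | succ k ih =>
    rw [Finset.sum_range_succ, mul_add]
    have h1 := ih (by omega)
    have h2 := rankCount_mul_le hmk
    linarith

/-- Bounds for the number of balanced quadratic functions, in the scaling of `rankCount`. -/
theorem balanced_bounds {m k : ℕ} (hk : m / 2 = k + 1) :
    let U := 2 * ∑ h ∈ Finset.range (k + 2), ((2 : ℤ) ^ m - 4 ^ h) * rankCount m h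
    (4 : ℤ) ^ (k + 1) * rankCount m (k + 1) ≤ U ∧
      (4 : ℤ) ^ k * rankCount m k * U ≤ ((4 : ℤ) ^ (k + 1) * rankCount m (k + 1)) ^ 2 := by
  intro U
  have hU : U = 2 * (∑ h ∈ Finset.range k, ((2 : ℤ) ^ m - 4 ^ h) * rankCount m h +
      (2 ^ m - 4 ^ k) * rankCount m k + (2 ^ m - 4 ^ k * 4) * rankCount m (k + 1)) := by
    simp only [U, Finset.sum_range_succ, pow_succ]
  have hσ0 : 0 ≤ ∑ h ∈ Finset.range k, ((2 : ℤ) ^ m - 4 ^ h) * rankCount m h :=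
    Finset.sum_nonneg fun h hh => mul_nonneg
      (sub_nonneg.2 (four_pow_le_two_pow (by have := Finset.mem_range.1 hh; omega)))
      (Nat.cast_nonneg _)
  have hσ : 25 * ∑ h ∈ Finset.range k, ((2 : ℤ) ^ m - 4 ^ h) * rankCount m h ≤
      2 ^ m * rankCount m k := by
    have h1 : ∑ h ∈ Finset.range k, ((2 : ℤ) ^ m - 4 ^ h) * rankCount m h ≤
        2 ^ m * ∑ h ∈ Finset.range k, (rankCount m h : ℤ) := by
      rw [Finset.mul_sum]
      refine Finset.sum_le_sum fun h _ => mul_le_mul_of_nonneg_right ?_ (Nat.cast_nonneg _)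
      exact sub_le_self _ (by positivity)
    have h2 := mul_le_mul_of_nonneg_left (sum_rankCount_le (m := m) (k := k) (by omega))
      (by positivity : (0 : ℤ) ≤ 2 ^ m)
    linarith
  have hr := rankCount_ratio m k
  have ht : (1 : ℤ) ≤ 4 ^ k := one_le_pow₀ (by norm_num)
  have hM₀ : (0 : ℤ) ≤ rankCount m k := Nat.cast_nonneg _
  have hM₁ : (0 : ℤ) ≤ rankCount m (k + 1) := Nat.cast_nonneg _
  -- The parity of `m` fixes `2 ^ m` in terms of `t = 4 ^ k`, so the last ratio becomes explicit.
  have hx : (2 : ℤ) ^ m = 4 * 4 ^ k ∨ (2 : ℤ) ^ m = 8 * 4 ^ k := by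
    rw [show (4 : ℤ) ^ k = 2 ^ (2 * k) by rw [pow_mul]; norm_num]
    rcases (by omega : m = 2 * k + 2 ∨ m = 2 * k + 3) with rfl | rfl
    · left; ring
    · right; ring
  rw [hU, pow_succ]
  generalize (∑ h ∈ Finset.range k, ((2 : ℤ) ^ m - 4 ^ h) * rankCount m h) = σ at *
  generalize (2 : ℤ) ^ m = x at *
  generalize (4 : ℤ) ^ k = t at *
  generalize (rankCount m k : ℤ) = M₀ at *
  generalize (rankCount m (k + 1) : ℤ) = M₁ at *
  have htM₀ : 0 ≤ t * M₀ := mul_nonneg (by linarith) hM₀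
  have htM₁ : 0 ≤ t * M₁ := mul_nonneg (by linarith) hM₁
  have hM₁t : M₁ ≤ t * M₁ := le_mul_of_one_le_left hM₁ ht
  rcases hx with rfl | rfl
  · have hr' : (4 * t - 1) * M₁ = 3 * t * M₀ := by
      refine mul_left_cancel₀ (by linarith : 2 * t ≠ 0) ?_
      linear_combination hr
    have h34 : 3 * (t * M₀) ≤ 4 * (t * M₁) := by linarith
    constructor
    · linarith
    -- For even `m` the top-rank term vanishes, and `2 * (4 / 25 + 3) < 7 ≤ 3 ^ 2`.
    · have h1 : 2 * (σ + (4 * t - t) * M₀ + (4 * t - t * 4) * M₁) ≤ 7 * (t * M₀) := by linarith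
      calc t * M₀ * (2 * (σ + (4 * t - t) * M₀ + (4 * t - t * 4) * M₁))
          ≤ t * M₀ * (7 * (t * M₀)) := mul_le_mul_of_nonneg_left h1 htM₀
        _ ≤ (3 * (t * M₀)) ^ 2 := by nlinarith
        _ ≤ (4 * (t * M₁)) ^ 2 := pow_le_pow_left₀ (by linarith) h34 2
        _ = (t * 4 * M₁) ^ 2 := by ring
  · have hr' : (4 * t - 1) * M₁ = 21 * t * M₀ := by
      refine mul_left_cancel₀ (by linarith : 2 * t ≠ 0) ?_
      linear_combination hr
    have h34 : 21 * (t * M₀) ≤ 4 * (t * M₁) := by linarith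
    constructor
    · linarith
    -- For odd `m` the top-rank term contributes `8 * (t * M₁)`; by `h34` the others add `2 * (8 /
    -- 25 + 7) * 4 / 21 < 4` times `t * M₁`. The target allows `16`.
    · have h1 : 2 * (σ + (8 * t - t) * M₀ + (8 * t - t * 4) * M₁) ≤ 12 * (t * M₁) := by linarith
      calc t * M₀ * (2 * (σ + (8 * t - t) * M₀ + (8 * t - t * 4) * M₁))
          ≤ t * M₁ * (12 * (t * M₁)) :=
            mul_le_mul (by linarith) h1 (by nlinarith) htM₁
        _ ≤ (t * 4 * M₁) ^ 2 := by nlinarith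

end Inequalities

/-! ### The lower half of the weight distribution, up to the balanced words. -/

section HalfSequence

/-- The number of codewords of `R(2, m)` of weight `2 ^ (m - 1) ± 2 ^ (m - 1 - h)` if `h ≤ m / 2`,
and of weight `2 ^ (m - 1)` otherwise. -/
noncomputable def halfSeq (m h : ℕ) : ℕ :=
  charSumCount (Fin m → ZMod 2) (if h ≤ m / 2 then 2 ^ (m - h) else 0)

theorem two_mul_halfSeq {m h : ℕ} (hmh : h ≤ m / 2) :
    2 * (2 : ℤ) ^ m * halfSeq m h = 4 ^ h * rankCount m h := by
  have h1 := two_mul_card_mul_charSumCount (Fin m → ZMod 2) (s := 2 ^ (m - h)) (h := h)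
    (by positivity) (by
      rw [natCard_cube, show (4 : ℤ) = 2 ^ 2 by norm_num, Nat.cast_pow, Nat.cast_ofNat,
        ← pow_mul, ← pow_mul, ← pow_add, ← pow_mul]
      congr 1
      omega)
  rw [natCard_cube] at h1
  rw [halfSeq, if_pos hmh]
  exact_mod_cast h1

theorem two_mul_halfSeq_middle (m : ℕ) :
    2 * (2 : ℤ) ^ m * halfSeq m (m / 2 + 1) =
      2 * ∑ h ∈ Finset.range (m / 2 + 1), ((2 : ℤ) ^ m - 4 ^ h) * rankCount m h := by
  have h1 := card_mul_charSumCount_zero (Fin m → ZMod 2) (K := m / 2 + 1) (by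
    rw [natCard_cube, show 4 = 2 ^ 2 from rfl, ← pow_mul]
    exact Nat.pow_lt_pow_right (by norm_num) (by omega))
  rw [natCard_cube] at h1
  push_cast at h1
  rw [halfSeq, if_neg (by omega), mul_assoc, h1]
  rfl

theorem halfSeq_pos {m h : ℕ} (hmh : h ≤ m / 2) : 0 < halfSeq m h := by
  have h1 := two_mul_halfSeq hmh
  have h2 := rankCount_pos (m := m) (h := h) (by omega)
  have h3 : (0 : ℤ) < 2 * (2 : ℤ) ^ m * halfSeq m h := by rw [h1]; positivity
  exact_mod_cast pos_of_mul_pos_right h3 (by positivity)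

theorem halfSeq_le_succ {m h : ℕ} (hm : 2 ≤ m) (hmh : h ≤ m / 2) :
    halfSeq m h ≤ halfSeq m (h + 1) := by
  have key : 2 * (2 : ℤ) ^ m * halfSeq m h ≤ 2 * (2 : ℤ) ^ m * halfSeq m (h + 1) := by
    rcases hmh.lt_or_eq with hlt | rfl
    · rw [two_mul_halfSeq hmh, two_mul_halfSeq hlt, pow_succ, mul_assoc]
      exact mul_le_mul_of_nonneg_left (rankCount_le_four_mul (by omega)) (by positivity)
    -- The last step compares the top rank with the balanced words; `2 ≤ m` makes `m / 2` positive.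
    · obtain ⟨k, hk⟩ : ∃ k, m / 2 = k + 1 := ⟨m / 2 - 1, by omega⟩
      rw [two_mul_halfSeq le_rfl, two_mul_halfSeq_middle, hk]
      exact (balanced_bounds hk).1
  exact_mod_cast le_of_mul_le_mul_left key (by positivity)

theorem halfSeq_logConcave {m h : ℕ} (hmh : h + 1 ≤ m / 2) :
    halfSeq m h * halfSeq m (h + 2) ≤ halfSeq m (h + 1) ^ 2 := by
  have key : (2 * (2 : ℤ) ^ m * halfSeq m h) * (2 * (2 : ℤ) ^ m * halfSeq m (h + 2)) ≤
      (2 * (2 : ℤ) ^ m * halfSeq m (h + 1)) ^ 2 := by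
    rcases hmh.lt_or_eq with hlt | heq
    · rw [two_mul_halfSeq (h := h) (by omega), two_mul_halfSeq hmh,
        two_mul_halfSeq (h := h + 2) hlt]
      have h1 := mul_le_mul_of_nonneg_left (rankCount_logConcave (m := m) (h := h) (by omega))
        (by positivity : (0 : ℤ) ≤ 4 ^ h * 4 ^ (h + 2))
      calc _ = (4 : ℤ) ^ h * 4 ^ (h + 2) * (rankCount m h * rankCount m (h + 2)) := by ring
        _ ≤ _ := h1
        _ = _ := by ring
    · have h2 := two_mul_halfSeq_middle m
      rw [← heq] at h2
      rw [two_mul_halfSeq (h := h) (by omega), two_mul_halfSeq hmh, h2]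
      exact (balanced_bounds heq.symm).2
  have h3 : (2 * (2 : ℤ) ^ m) ^ 2 * (halfSeq m h * halfSeq m (h + 2)) ≤
      (2 * (2 : ℤ) ^ m) ^ 2 * halfSeq m (h + 1) ^ 2 := by linarith [key]
  exact_mod_cast le_of_mul_le_mul_left h3 (by positivity)

end HalfSequence

/-! ### The list of weights and reflection at the middle. -/

section WeightList

/-- The `k`-th weight of `R(2, m)`, for `k ≤ 2 * (m / 2 + 1)`. -/
def rmWeight (m k : ℕ) : ℕ :=
  if k ≤ m / 2 then 2 ^ (m - 1) - 2 ^ (m - 1 - k)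
  else if k = m / 2 + 1 then 2 ^ (m - 1)
  else 2 ^ (m - 1) + 2 ^ (m - 1 - (2 * (m / 2 + 1) - k))

theorem rmWeight_lt {m k l : ℕ} (hm : 2 ≤ m) (hkl : k < l) (hl : l ≤ 2 * (m / 2 + 1)) :
    rmWeight m k < rmWeight m l := by
  have hpos : ∀ j, 0 < 2 ^ j := fun j => by positivity
  have hle : ∀ j, 2 ^ (m - 1 - j) ≤ 2 ^ (m - 1) :=
    fun j => Nat.pow_le_pow_right (by norm_num) (by omega)
  have hlt : ∀ i j, i < j → j ≤ m - 1 → 2 ^ (m - 1 - j) < 2 ^ (m - 1 - i) :=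
    fun i j _ _ => Nat.pow_lt_pow_right (by norm_num) (by omega)
  unfold rmWeight
  have h1 := hpos (m - 1 - k)
  have h2 := hpos (m - 1 - l)
  have h3 := hpos (m - 1 - (2 * (m / 2 + 1) - l))
  have h4 := hle k
  have h5 := hle l
  split_ifs
  any_goals omega
  · have := hlt k l hkl (by omega)
    omega
  · have := hlt (2 * (m / 2 + 1) - l) (2 * (m / 2 + 1) - k) (by omega) (by omega)
    omega

theorem rmWeight_le {m k : ℕ} (hm : 2 ≤ m) : rmWeight m k ≤ 2 ^ m := by
  have h1 : 2 ^ m = 2 * 2 ^ (m - 1) := by rw [← pow_succ']; congr 1; omega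
  have hle : ∀ j, 2 ^ (m - 1 - j) ≤ 2 ^ (m - 1) :=
    fun j => Nat.pow_le_pow_right (by norm_num) (by omega)
  have h2 := hle (2 * (m / 2 + 1) - k)
  have h3 := Nat.sub_le (2 ^ (m - 1)) (2 ^ (m - 1 - k))
  unfold rmWeight
  split_ifs <;> omega

theorem weightDist_rmWeight {m k : ℕ} (hm : 2 ≤ m) (hk : k ≤ 2 * (m / 2 + 1)) :
    weightDist (reedMuller 2 m) (rmWeight m k) = halfSeq m (min k (2 * (m / 2 + 1) - k)) := by
  have h1 : (2 : ℤ) ^ m = 2 * 2 ^ (m - 1) := by rw [← pow_succ']; congr 1; omega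
  have h2 : ∀ j, j ≤ m - 1 → (2 : ℤ) ^ (m - j) = 2 * 2 ^ (m - 1 - j) := fun j hj => by
    rw [← pow_succ']; congr 1; omega
  rw [weightDist_reedMuller_two, halfSeq, rmWeight]
  split_ifs with h3 h4 h5 h6 h7
  any_goals omega
  · rw [min_eq_left (by omega), Nat.cast_sub (Nat.pow_le_pow_right (by norm_num) (by omega)),
      h2 k (by omega), h1]
    congr 1
    push_cast
    ring
  · congr 1
    rw [h1]
    push_cast
    ring
  · rw [min_eq_right (by omega), h2 _ (by omega), h1, ← charSumCount_neg]
    congr 1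
    push_cast
    ring

theorem halfSeq_pos_of_le {m h : ℕ} (hm : 2 ≤ m) (hmh : h ≤ m / 2 + 1) : 0 < halfSeq m h := by
  rcases hmh.lt_or_eq with hlt | rfl
  · exact halfSeq_pos (by omega)
  · exact (halfSeq_pos le_rfl).trans_le (halfSeq_le_succ hm le_rfl)

/-- A nonzero character sum is `± 2 ^ (m - h)` for some rank `2 * h ≤ m`; the sign decides on which
side of `2 ^ (m - 1)` the weight lies. -/
theorem exists_rmWeight_eq {m i : ℕ} (hm : 2 ≤ m) (hi : weightDist (reedMuller 2 m) i ≠ 0) :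
    ∃ k ≤ 2 * (m / 2 + 1), rmWeight m k = i := by
  have hpm : 2 ^ m = 2 * 2 ^ (m - 1) := by rw [← pow_succ']; congr 1; omega
  have hpm' : (2 : ℤ) ^ m = 2 * 2 ^ (m - 1) := by exact_mod_cast hpm
  rw [weightDist_reedMuller_two] at hi
  by_cases hs : (2 : ℤ) ^ m - 2 * i = 0
  · refine ⟨m / 2 + 1, by omega, ?_⟩
    rw [rmWeight, if_neg (by omega), if_pos rfl]
    zify
    linarith
  have hex : ∃ h : ℕ, ((2 : ℤ) ^ m - 2 * i) ^ 2 * 4 ^ h = (Nat.card (Fin m → ZMod 2) : ℤ) ^ 2 := by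
    by_contra hne
    push Not at hne
    exact hi (charSumCount_eq_zero _ hs hne)
  obtain ⟨h, hh⟩ := hex
  have hmh : 2 * h ≤ m := by
    by_contra hlt
    have h1 := two_mul_card_mul_charSumCount (Fin m → ZMod 2) hs hh
    change _ = 4 ^ h * rankCount m h at h1
    rw [rankCount_eq_zero (by omega), natCard_cube, mul_zero, mul_eq_zero] at h1
    exact h1.elim (by positivity) hi
  have hsq : ((2 : ℤ) ^ m - 2 * i) ^ 2 = (2 ^ (m - h)) ^ 2 := by
    refine mul_right_cancel₀ (pow_ne_zero h (four_ne_zero (α := ℤ))) ?_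
    rw [hh, natCard_cube, show (4 : ℤ) = 2 ^ 2 by norm_num, Nat.cast_pow, Nat.cast_ofNat,
      ← pow_mul, ← pow_mul, ← pow_mul, ← pow_add]
    congr 1
    omega
  have hph : (2 : ℤ) ^ (m - h) = 2 * 2 ^ (m - 1 - h) := by rw [← pow_succ']; congr 1; omega
  have hle : 2 ^ (m - 1 - h) ≤ 2 ^ (m - 1) := Nat.pow_le_pow_right (by norm_num) (by omega)
  rcases sq_eq_sq_iff_eq_or_eq_neg.1 hsq with h1 | h1
  · refine ⟨h, by omega, ?_⟩
    rw [rmWeight, if_pos (by omega)]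
    zify [hle]
    linarith
  · refine ⟨2 * (m / 2 + 1) - h, by omega, ?_⟩
    rw [rmWeight, if_neg (by omega), if_neg (by omega),
      show 2 * (m / 2 + 1) - (2 * (m / 2 + 1) - h) = h by omega]
    zify
    linarith

theorem weights_reedMuller_two {m : ℕ} (hm : 2 ≤ m) :
    weights (reedMuller 2 m) = (List.range (2 * (m / 2 + 1) + 1)).map (rmWeight m) := by
  refine List.SortedLT.eq_of_mem_iff ?_ ?_ fun i => ?_
  · exact (List.pairwise_lt_range.filter _).sortedLT
  · refine List.Pairwise.sortedLT (List.pairwise_map.2 ?_)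
    exact List.pairwise_lt_range.imp_of_mem fun _ hl hkl =>
      rmWeight_lt hm hkl (Nat.lt_succ_iff.1 (List.mem_range.1 hl))
  · simp only [weights, List.mem_filter, List.mem_range, List.mem_map, decide_eq_true_eq,
      Fintype.card_pi, ZMod.card, Finset.prod_const, Finset.card_univ, Fintype.card_fin,
      Nat.lt_succ_iff]
    constructor
    · rintro ⟨-, hi⟩
      exact exists_rmWeight_eq hm hi
    · rintro ⟨k, hk, rfl⟩
      refine ⟨rmWeight_le hm, ?_⟩
      rw [weightDist_rmWeight hm hk]
      exact (halfSeq_pos_of_le hm (by omega)).ne'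

theorem nonzeroWeightDist_reedMuller_two {m : ℕ} (hm : 2 ≤ m) :
    nonzeroWeightDist (reedMuller 2 m) = (List.range (2 * (m / 2 + 1) + 1)).map
      fun k => halfSeq m (min k (2 * (m / 2 + 1) - k)) := by
  rw [nonzeroWeightDist, weights_reedMuller_two hm, List.map_map]
  refine List.map_congr_left fun k hk => ?_
  exact weightDist_rmWeight hm (Nat.lt_succ_iff.1 (List.mem_range.1 hk))

/-- A log-concave nondecreasing sequence `b 0, …, b K` reflected at its last term is
log-concave. -/
theorem isLogConcave_reflect {b : ℕ → ℕ} {K : ℕ} (hmono : ∀ i, i + 1 ≤ K → b i ≤ b (i + 1))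
    (hlog : ∀ i, i + 2 ≤ K → b i * b (i + 2) ≤ b (i + 1) ^ 2) :
    IsLogConcave ((List.range (2 * K + 1)).map fun k => b (min k (2 * K - k))) := by
  intro i hi
  simp only [List.length_map, List.length_range] at hi
  simp only [List.getElem_map, List.getElem_range]
  rcases lt_trichotomy (i + 1) K with h | h | h
  · rw [show min i (2 * K - i) = i by omega, show min (i + 1) (2 * K - (i + 1)) = i + 1 by omega,
      show min (i + 2) (2 * K - (i + 2)) = i + 2 by omega]
    exact hlog i h
  -- At the peak both neighbours are equal, so monotonicity alone suffices.
  · rw [show min i (2 * K - i) = i by omega, show min (i + 1) (2 * K - (i + 1)) = i + 1 by omega,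
      show min (i + 2) (2 * K - (i + 2)) = i by omega, ← sq]
    exact Nat.pow_le_pow_left (hmono i h.le) 2
  · obtain ⟨j, hj⟩ : ∃ j, i + 2 + j = 2 * K := ⟨2 * K - (i + 2), by omega⟩
    rw [show min i (2 * K - i) = j + 2 by omega,
      show min (i + 1) (2 * K - (i + 1)) = j + 1 by omega,
      show min (i + 2) (2 * K - (i + 2)) = j by omega, mul_comm]
    exact hlog j (by omega)

theorem isUnimodalAt_reflect {b : ℕ → ℕ} {K : ℕ} (hmono : ∀ i, i + 1 ≤ K → b i ≤ b (i + 1)) :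
    IsUnimodalAt ((List.range (2 * K + 1)).map fun k => b (min k (2 * K - k))) K := by
  simp only [IsUnimodalAt, List.length_map, List.length_range, List.getElem_map,
    List.getElem_range]
  refine ⟨by omega, fun i hi hiK => ?_, fun i hi hiK => ?_⟩
  · rw [min_eq_left (by omega), min_eq_left (by omega)]
    exact hmono i hiK
  · rw [min_eq_right (by omega), min_eq_right (by omega),
      show 2 * K - i = 2 * K - (i + 1) + 1 by omega]
    exact hmono _ (by omega)

end WeightList

end CodeLogConcave

theorem mainTheorem3 (m : ℕ) (hm : 2 ≤ m) :
    CodeLogConcave.IsLogConcave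
        (CodeLogConcave.nonzeroWeightDist (CodeLogConcave.reedMuller 2 m)) ∧
      ∃ j : ℕ,
        (CodeLogConcave.weights (CodeLogConcave.reedMuller 2 m))[j]? = some (2 ^ (m - 1)) ∧
        CodeLogConcave.IsUnimodalAt
          (CodeLogConcave.nonzeroWeightDist (CodeLogConcave.reedMuller 2 m)) j := by
  have hmono : ∀ i, i + 1 ≤ m / 2 + 1 →
      CodeLogConcave.halfSeq m i ≤ CodeLogConcave.halfSeq m (i + 1) :=
    fun i hi => CodeLogConcave.halfSeq_le_succ hm (by omega)
  rw [CodeLogConcave.nonzeroWeightDist_reedMuller_two hm]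
  refine ⟨CodeLogConcave.isLogConcave_reflect hmono fun i hi =>
    CodeLogConcave.halfSeq_logConcave (by omega), m / 2 + 1, ?_,
    CodeLogConcave.isUnimodalAt_reflect hmono⟩
  rw [CodeLogConcave.weights_reedMuller_two hm, List.getElem?_map,
    List.getElem?_range (by omega), Option.map_some, CodeLogConcave.rmWeight,
    if_neg (by omega), if_pos rfl]
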